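/- For a finite simple graph $G$, a (not necessarily proper) vertex-colouring is called complete if any two different colours used occur on the two ends of some edge of $G$; the pseudoachromatic number $\psi(G)$ is the largest number of colours used in a complete vertex-colouring of $G$. For $m\ge 1$ let $\psi(m):=\psi(L(K_m))$ be the pseudoachromatic number of the line graph $L(K_m)$ of the complete graph $K_m$. Theorem. Let $q>4$ be a power of $2$, let $n=q^2+q+1$, let $a\in\left\{-1,0,1,\dots,\left\lceil\frac{1+\sqrt{4q+9}}{2}\right\rceil-1\right\}$ and let $m_a=n+q-a$ (that is, $m_a=(q+1)^2-a$). Then \[\psi(m_a)=(m_a-a)\,q .\] -/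

import Mathlib

namespace SimpleGraph

/-- A complete colouring of the vertices of `G` with exactly `k` colours: all `k` colours are used,
and any two different colours occur on the two ends of some edge. (The colouring need not be
proper.) -/
def IsCompleteVertexColouring {V : Type*} (G : SimpleGraph V) {k : ℕ} (c : V → Fin k) : Prop :=
  Function.Surjective c ∧
    ∀ i j : Fin k, i ≠ j → ∃ u v : V, G.Adj u v ∧ c u = i ∧ c v = j

/-- The pseudoachromatic number of a finite graph: the largest number of colours in a complete
vertex-colouring. -/
noncomputable def pseudoachromaticNumber {V : Type*} (G : SimpleGraph V) : ℕ :=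
  sSup {k : ℕ | ∃ c : V → Fin k, G.IsCompleteVertexColouring c}

/-- On a finite graph the supremum in the definition is a maximum. -/
theorem isGreatest_pseudoachromaticNumber {V : Type*} [Finite V] (G : SimpleGraph V) :
    IsGreatest {k : ℕ | ∃ c : V → Fin k, G.IsCompleteVertexColouring c}
      G.pseudoachromaticNumber := by
  have hb : BddAbove {k : ℕ | ∃ c : V → Fin k, G.IsCompleteVertexColouring c} := by
    refine ⟨Nat.card V, ?_⟩
    rintro k ⟨c, hc, -⟩
    simpa using Nat.card_le_card_of_surjective c hc
  have hne : {k : ℕ | ∃ c : V → Fin k, G.IsCompleteVertexColouring c}.Nonempty := by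
    rcases isEmpty_or_nonempty V with hV | hV
    · exact ⟨0, fun v => isEmptyElim v, fun i => i.elim0, fun i => i.elim0⟩
    · exact ⟨1, fun _ => 0, fun i => ⟨Classical.arbitrary V, Subsingleton.elim _ _⟩,
        fun i j h => absurd (Subsingleton.elim i j) h⟩
  exact ⟨Nat.sSup_mem hne hb, fun k hk => le_csSup hb hk⟩

end SimpleGraph

/-- The pseudoachromatic index `ψ(m)` of the complete graph on `m` vertices: the pseudoachromatic
number of its line graph. -/
noncomputable def completeGraphPseudoachromaticIndex (m : ℕ) : ℕ :=
  (SimpleGraph.completeGraph (Fin m)).lineGraph.pseudoachromaticNumber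

/-! Upper bound. Let `t = q / 2` and `K = (m - a) * q`. With `K + 1` colours some class has at most
`t` edges: twice the slack in `m.choose 2 < (K + 1) * (t + 1)` is `q + 2 - a * (a - 1)`, positive by
the bound on `a`. Every colour then occurs on an edge that meets a set of `q` vertices, and there
are too few such edges (`completeGraphPseudoachromaticIndex_lt`).

Lower bound. The vertices are the points of the projective plane over the field with `q` elements
and `q - a` extra ones. A line has `q + 1` points, an odd number, so its pairs split into `q + 1`
near-perfect matchings, one for each flag, missing the point of the flag. If each class also reached
the point it misses, two flag colours would meet where their lines meet. An extra vertex repairs all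
affine flags of one parallel class: its edge to `p` gets the colour of the flag of `p` in that
class. There are `q + 1` parallel classes, so `N = a + 1` distinguished classes `P l` remain.

For each of these, a layer of `2 * q` colour classes is dissolved: one flag `y` on each of the `q`
affine lines of the class `P l`, and the flags at infinity of the `q` lines `b l s`, `s ≠ P l`, of a
dual hyperoval. This frees `q ^ 2` edges. By Hall's theorem each of the `q ^ 2 - q` points other
than the `y` gets a freed edge at itself (`IsDualHyperoval.exists_owned_pairs`); the other `q` freed
edges end at the infinite point `P l`. With the edges from infinite points to extra vertices they
repair the flags at infinity and make room for `q - 1` colours `sig`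
(`LayeredPlane.exists_complete_colouring`). In all `(q ^ 2 + q + 1) * (q + 1) + (q - 1) - 2 * q * N
= K` colours are used. -/

section

open Finset

/-! ### Colourings of pairs, and the counting upper bound. -/

/-- A symmetric colouring of the pairs of distinct vertices such that any two colours of `G` occur
at a common vertex bounds the pseudoachromatic index from below. -/
theorem card_le_completeGraphPseudoachromaticIndex {V C : Type*} [Fintype V] [DecidableEq C]
    (col : V → V → C) (hsymm : ∀ u v, col u v = col v u) (G : Finset C) (hG : 2 ≤ G.card)
    (h : ∀ X ∈ G, ∀ Y ∈ G, X ≠ Y → ∃ u, (∃ v, v ≠ u ∧ col u v = X) ∧ ∃ v, v ≠ u ∧ col u v = Y) :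
    G.card ≤ completeGraphPseudoachromaticIndex (Fintype.card V) := by
  classical
  set e := Fintype.equivFin V with he
  obtain ⟨X₀, hX₀⟩ : G.Nonempty := card_pos.1 (by omega)
  -- Colours outside `G` are merged into the arbitrary colour `X₀`; this destroys no incidence
  -- between colours of `G`.
  set g : C → Fin G.card := fun X => G.equivFin (if hX : X ∈ G then ⟨X, hX⟩ else ⟨X₀, hX₀⟩) with hg
  have hg' : ∀ X, ∀ hX : X ∈ G, g X = G.equivFin ⟨X, hX⟩ := by
    intro X hX; simp [hg, hX]
  set f : Sym2 (Fin (Fintype.card V)) → Fin G.card :=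
    Sym2.lift ⟨fun u v => g (col (e.symm u) (e.symm v)), fun u v => congrArg g (hsymm _ _)⟩ with hf
  have key : ∀ i j : Fin G.card, i ≠ j → ∃ u v :
      (SimpleGraph.completeGraph (Fin (Fintype.card V))).edgeSet,
      (SimpleGraph.completeGraph (Fin (Fintype.card V))).lineGraph.Adj u v ∧
        f u.1 = i ∧ f v.1 = j := by
    intro i j hij
    obtain ⟨u, ⟨v, hv, hvX⟩, w, hw, hwY⟩ := h (G.equivFin.symm i) (G.equivFin.symm i).2
      (G.equivFin.symm j) (G.equivFin.symm j).2
      (fun hh => hij (G.equivFin.symm.injective (Subtype.ext hh)))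
    have hi : f s(e u, e v) = i := by
      simp [hf, hvX, hg' _ (G.equivFin.symm i).2]
    have hj : f s(e u, e w) = j := by
      simp [hf, hwY, hg' _ (G.equivFin.symm j).2]
    refine ⟨⟨s(e u, e v), by simpa [SimpleGraph.completeGraph] using hv.symm⟩,
      ⟨s(e u, e w), by simpa [SimpleGraph.completeGraph] using hw.symm⟩, ?_, hi, hj⟩
    rw [SimpleGraph.lineGraph_adj_iff_exists]
    refine ⟨fun hh => hij ?_, e u, by simp, by simp⟩
    rw [← hi, ← hj]
    exact congrArg f (congrArg Subtype.val hh)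
  refine (SimpleGraph.isGreatest_pseudoachromaticNumber _).2 ⟨fun x => f x.1, ?_, key⟩
  intro i
  obtain ⟨j, hj⟩ : ∃ j : Fin G.card, i ≠ j := by
    have : Nontrivial (Fin G.card) := Fin.nontrivial_iff_two_le.2 hG
    obtain ⟨j, hj⟩ := exists_ne i
    exact ⟨j, hj.symm⟩
  obtain ⟨u, -, -, hu, -⟩ := key i j hj
  exact ⟨u, hu⟩

/-- If there are more colours than an average class size allows, then some class has at most `t`
edges, and the colours all occur at its at most `2 * t` end vertices. -/
theorem completeGraphPseudoachromaticIndex_lt {m t k : ℕ} (htm : 2 * t ≤ m)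
    (hk : m.choose 2 < k * (t + 1)) (hk2 : 2 ≤ k)
    (hk' : 2 * t * (m - 2 * t) + (2 * t + 1).choose 2 < k) :
    completeGraphPseudoachromaticIndex m < k := by
  classical
  by_contra! hle
  obtain ⟨⟨c, -, hcc⟩, -⟩ := SimpleGraph.isGreatest_pseudoachromaticNumber
    (SimpleGraph.completeGraph (Fin m)).lineGraph
  change (∀ i j : Fin (completeGraphPseudoachromaticIndex m), _) at hcc
  set K := completeGraphPseudoachromaticIndex m
  change (SimpleGraph.completeGraph (Fin m)).edgeSet → Fin K at c
  have hcard : Fintype.card (SimpleGraph.completeGraph (Fin m)).edgeSet = m.choose 2 := by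
    have := SimpleGraph.card_edgeFinset_top_eq_card_choose_two (V := Fin m)
    rw [Fintype.card_fin] at this
    rw [← this, SimpleGraph.edgeFinset_card]
  obtain ⟨i, -, hi⟩ := exists_card_fiber_lt_of_card_lt_mul (s := univ) (t := univ) (f := c)
    (n := t + 1) (by
      rw [card_univ, card_univ, hcard, Fintype.card_fin]
      exact hk.trans_le (Nat.mul_le_mul_right _ hle))
  set U₀ : Finset (Fin m) := (univ.filter fun x => c x = i).biUnion fun x => x.1.toFinset with hU₀
  have hU₀c : U₀.card ≤ 2 * t := by
    refine (card_biUnion_le_card_mul _ _ 2 fun x _ => ?_).trans (by omega)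
    rw [Sym2.card_toFinset]
    split_ifs <;> omega
  obtain ⟨U, hU, hUc⟩ := exists_superset_card_eq hU₀c (by simpa using htm)
  -- `U.sym2` also counts the loops on `U`, hence `(2 * t + 1).choose 2`; the bound is still strong
  -- enough.
  set S : Finset (Sym2 (Fin m)) := (U ×ˢ Uᶜ).image (fun x => s(x.1, x.2)) ∪ U.sym2 with hS
  have hSc : S.card ≤ 2 * t * (m - 2 * t) + (2 * t + 1).choose 2 := by
    refine (card_union_le _ _).trans (Nat.add_le_add (card_image_le.trans ?_) ?_)
    · rw [card_product, card_compl, hUc, Fintype.card_fin]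
    · rw [card_sym2, hUc]
  have hmem : ∀ x : Sym2 (Fin m), ∀ u ∈ x, u ∈ U → x ∈ S := by
    intro x u hu huU
    obtain ⟨v, rfl⟩ := Sym2.mem_iff_exists.1 hu
    by_cases hv : v ∈ U
    · exact mem_union_right _ (by simp [huU, hv])
    · exact mem_union_left _ (mem_image.2 ⟨(u, v), by simp [huU, hv], rfl⟩)
  have hsurj : ∀ j : Fin K, ∃ x : (SimpleGraph.completeGraph (Fin m)).edgeSet,
      c x = j ∧ x.1 ∈ S := by
    have main : ∀ j : Fin K, j ≠ i → ∃ x y : (SimpleGraph.completeGraph (Fin m)).edgeSet,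
        c x = i ∧ c y = j ∧ x.1 ∈ S ∧ y.1 ∈ S := by
      intro j hj
      obtain ⟨x, y, hxy, hx, hy⟩ := hcc i j hj.symm
      rw [SimpleGraph.lineGraph_adj_iff_exists] at hxy
      obtain ⟨-, u, hux, huy⟩ := hxy
      have huU : u ∈ U := hU (mem_biUnion.2 ⟨x, by simp [hx], by simpa using hux⟩)
      exact ⟨x, y, hx, hy, hmem _ u hux huU, hmem _ u huy huU⟩
    intro j
    by_cases hj : j = i
    · have : Nontrivial (Fin K) := Fin.nontrivial_iff_two_le.2 (hk2.trans hle)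
      obtain ⟨j', hj'⟩ := exists_ne i
      obtain ⟨x, -, hx, -, hxS, -⟩ := main j' hj'
      exact ⟨x, hx.trans hj.symm, hxS⟩
    · obtain ⟨-, y, -, hy, -, hyS⟩ := main j hj
      exact ⟨y, hy, hyS⟩
  choose g hg hgS using hsurj
  have : K ≤ S.card := by
    rw [← Fintype.card_fin K, ← card_univ]
    refine card_le_card_of_injOn (fun j => (g j).1) (fun j _ => hgS j) fun j _ j' _ h => ?_
    rw [← hg j, ← hg j', Subtype.ext h]
  omega

/-! ### Near-one-factorizations of odd sets. -/

/-- A set of odd size labelled by `ZMod (2 * h + 1)` inherits its midpoint operation. -/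
theorem exists_midpoint {X : Type*} (S : Finset X) {h : ℕ} (θ : X → ZMod (2 * h + 1))
    (hθ : Set.InjOn θ S) (hS : S.card = 2 * h + 1) :
    ∃ c : X → X → X, (∀ u v, c u v = c v u) ∧
      (∀ u v, c u v ∈ S ∧ 2 * θ (c u v) = θ u + θ v) ∧
      ∀ u ∈ S, ∀ w ∈ S, ∃ v ∈ S, θ u + θ v = 2 * θ w := by
  classical
  have hsurj : ∀ z : ZMod (2 * h + 1), ∃ x ∈ S, θ x = z := by
    have : S.image θ = univ := by
      rw [← card_eq_iff_eq_univ, card_image_of_injOn hθ, hS, ZMod.card]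
    intro z
    have hz : z ∈ S.image θ := this ▸ mem_univ z
    simpa using hz
  choose g hgS hg using hsurj
  have h2 : (2 : ZMod (2 * h + 1)) * (h + 1) = 1 := by
    have : ((2 * h + 1 : ℕ) : ZMod (2 * h + 1)) = 0 := ZMod.natCast_self _
    push_cast at this
    linear_combination this
  refine ⟨fun u v => g ((h + 1) * (θ u + θ v)), fun u v => by simp only [add_comm (θ u)],
    fun u v => ⟨hgS _, ?_⟩, fun u _ w _ => ⟨g (2 * θ w - θ u), hgS _, ?_⟩⟩
  · rw [hg]
    linear_combination (θ u + θ v) * h2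
  · rw [hg]
    ring

theorem exists_involution_swapping_half {A : Type*} [DecidableEq A] (L Q : Finset A) (hQ : Q ⊆ L)
    (h2 : 2 * Q.card = L.card) :
    ∃ κ : A → A, ∀ p ∈ L, κ p ∈ L ∧ κ (κ p) = p ∧ (p ∈ Q ↔ κ p ∉ Q) := by
  have hcard : Q.card = (L \ Q).card := by
    rw [card_sdiff_of_subset hQ]; omega
  let g := equivOfCardEq hcard
  refine ⟨fun p => if h : p ∈ Q then g ⟨p, h⟩ else if h : p ∈ L \ Q then g.symm ⟨p, h⟩ else p, ?_⟩
  intro p hp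
  by_cases h : p ∈ Q
  · have h1 := (g ⟨p, h⟩).2
    have h3 := (mem_sdiff.1 h1).2
    simp only [h, h1, h3, dif_pos, dif_neg, not_false_eq_true, (mem_sdiff.1 h1).1]
    simp
  · have h1 : p ∈ L \ Q := mem_sdiff.2 ⟨hp, h⟩
    have h3 := (g.symm ⟨p, h1⟩).2
    simp only [h, h1, dif_pos, dif_neg, not_false_eq_true, h3, hQ h3]
    simp

/-- The near-one-factorization of a line with an even number of points in `A` and the further point
`s`: the edge `u v` belongs to the class that misses the point `c u v`. The class that misses `y`
consists of the pairs `p, κ p` and of the pair `κ y, s`, where the involution `κ` exchanges a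
given half `Q` of `L` with its complement. -/
theorem exists_nearFactorization {A I : Type*} [DecidableEq A] (L Q : Finset A) (s : I)
    (hQ : Q ⊆ L) (h2 : 2 * Q.card = L.card) (hne : Q.Nonempty) :
    ∃ (c : A ⊕ I → A ⊕ I → A ⊕ I) (κ : A → A) (y : A), y ∈ L ∧ y ∉ Q ∧
      (∀ p ∈ L, κ p ∈ L ∧ κ (κ p) = p ∧ (p ∈ Q ↔ κ p ∉ Q)) ∧
      (∀ u v, c u v = c v u) ∧
      (∀ u ∈ L.disjSum {s}, ∀ w ∈ L.disjSum {s}, u ≠ w → ∃ v ∈ L.disjSum {s}, v ≠ u ∧ c u v = w) ∧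
      (∀ u ∈ L.disjSum {s}, ∀ v ∈ L.disjSum {s}, u ≠ v → c u v ∈ L.disjSum {s} ∧ c u v ≠ u) ∧
      (∀ p ∈ L, p ≠ y → p ≠ κ y → c (.inl p) (.inl (κ p)) = .inl y) ∧
      c (.inl (κ y)) (.inr s) = .inl y := by
  classical
  obtain ⟨κ, hκ⟩ := exists_involution_swapping_half L Q hQ h2
  set h := Q.card with hh
  have hh0 : 0 < h := card_pos.2 hne
  let n : A → ℕ := fun p => if hp : p ∈ Q then Q.equivFin ⟨p, hp⟩ else 0
  have hn : ∀ p ∈ Q, n p < h := fun p hp => by simp only [n, hp, dif_pos]; exact Fin.is_lt _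
  have hninj : ∀ p ∈ Q, ∀ p' ∈ Q, n p = n p' → p = p' := by
    intro p hp p' hp' hpp
    simp only [n, hp, hp', dif_pos] at hpp
    simpa using Q.equivFin.injective (Fin.ext hpp)
  let q₀ : A := Q.equivFin.symm ⟨0, hh0⟩
  have hq₀ : q₀ ∈ Q := (Q.equivFin.symm ⟨0, hh0⟩).2
  have hnq₀ : n q₀ = 0 := by simp only [n, hq₀, dif_pos]; simp [q₀]
  -- The pairs `p, κ p` get opposite labels, except that `q₀`, `κ q₀`, `s` get `1`, `0`, `-1`. The
  -- labels fill `-h, …, h`, and the class with midpoint `0` is the required one, with `y = κ q₀`.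
  let θ : A ⊕ I → ℤ := Sum.elim (fun p => if p ∈ Q then (n p : ℤ) + 1 else
    if n (κ p) = 0 then 0 else -((n (κ p) : ℤ) + 1)) (fun _ => -1)
  have hκQ : ∀ p ∈ L, p ∉ Q → κ p ∈ Q := fun p hp hpQ => by
    have := (hκ p hp).2.2; tauto
  have hθL : ∀ u ∈ L.disjSum {s}, -(h : ℤ) ≤ θ u ∧ θ u ≤ h := by
    rintro (p | t) hu
    · rw [inl_mem_disjSum] at hu
      by_cases hp : p ∈ Q
      · have := hn p hp
        simp only [θ, Sum.elim_inl, hp, if_true]; omega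
      · have := hn _ (hκQ p hu hp)
        simp only [θ, Sum.elim_inl, hp, if_false]; split_ifs <;> omega
    · simp only [θ, Sum.elim_inr]; omega
  have hθinj : ∀ u ∈ L.disjSum {s}, ∀ v ∈ L.disjSum {s}, θ u = θ v → u = v := by
    have haux : ∀ p ∈ L, ∀ t : I, θ (.inl p) ≠ θ (.inr t) := by
      intro p hp t
      simp only [θ, Sum.elim_inl, Sum.elim_inr]
      split_ifs <;> omega
    rintro (p | t) hu (p' | t') hv huv
    · rw [inl_mem_disjSum] at hu hv
      congr 1
      by_cases hp : p ∈ Q <;> by_cases hp' : p' ∈ Q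
      · simp only [θ, Sum.elim_inl, hp, hp', if_true] at huv
        exact hninj _ hp _ hp' (by omega)
      · simp only [θ, Sum.elim_inl, hp, hp', if_true, if_false] at huv
        split_ifs at huv <;> omega
      · simp only [θ, Sum.elim_inl, hp, hp', if_true, if_false] at huv
        split_ifs at huv <;> omega
      · simp only [θ, Sum.elim_inl, hp, hp', if_false] at huv
        rw [← (hκ p hu).2.1, ← (hκ p' hv).2.1,
          hninj _ (hκQ _ hu hp) _ (hκQ _ hv hp') (by split_ifs at huv <;> omega)]
    · exact absurd huv (haux p (by simpa using hu) t')
    · exact absurd huv.symm (haux p' (by simpa using hv) t)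
    · rw [inr_mem_disjSum, mem_singleton] at hu hv
      rw [hu, hv]
  have hcast : ∀ u ∈ L.disjSum {s}, ∀ v ∈ L.disjSum {s},
      (θ u : ZMod (2 * h + 1)) = θ v → u = v := by
    intro u hu v hv huv
    apply hθinj u hu v hv
    rw [ZMod.intCast_eq_intCast_iff_dvd_sub] at huv
    have h1 := hθL u hu
    have h3 := hθL v hv
    have := Int.eq_zero_of_abs_lt_dvd huv (by push_cast; rw [abs_lt]; constructor <;> omega)
    omega
  obtain ⟨c, hc, hc2, hc3⟩ := exists_midpoint (L.disjSum {s})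
    (fun u => (θ u : ZMod (2 * h + 1))) (fun u hu v hv => hcast u hu v hv)
    (by rw [card_disjSum, card_singleton, ← h2])
  have hcinj : ∀ u ∈ L.disjSum {s}, ∀ v ∈ L.disjSum {s},
      2 * (θ u : ZMod (2 * h + 1)) = 2 * θ v → u = v := by
    intro u hu v hv huv
    apply hcast u hu v hv
    have : ((2 * h + 1 : ℕ) : ZMod (2 * h + 1)) = 0 := ZMod.natCast_self _
    push_cast at this
    linear_combination (h + 1) * huv - (θ u - θ v) * this
  have hκq₀ : κ q₀ ∉ Q := (hκ q₀ (hQ hq₀)).2.2.1 hq₀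
  have hκκ : κ (κ q₀) = q₀ := (hκ q₀ (hQ hq₀)).2.1
  have hy : κ q₀ ∈ L := (hκ q₀ (hQ hq₀)).1
  have hθy : θ (.inl (κ q₀)) = 0 := by simp [θ, hκq₀, hκκ, hnq₀]
  have hyline : Sum.inl (κ q₀) ∈ L.disjSum {s} := inl_mem_disjSum.2 hy
  refine ⟨c, κ, κ q₀, hy, hκq₀, hκ, hc, ?_, ?_, ?_, ?_⟩
  · intro u hu w hw huw
    obtain ⟨v, hv, huv⟩ := hc3 u hu w hw
    refine ⟨v, hv, fun hvu => huw ?_, hcinj _ (hc2 u v).1 _ hw ((hc2 u v).2.trans huv)⟩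
    subst hvu
    exact hcinj _ hu _ hw (by linear_combination huv)
  · intro u hu v hv huv
    refine ⟨(hc2 u v).1, fun h => huv (hcast u hu v hv ?_)⟩
    have := (hc2 u v).2
    rw [h] at this
    linear_combination this
  · intro p hp hpy hpκ
    rw [hκκ] at hpκ
    refine hcinj _ (hc2 _ _).1 _ hyline ((hc2 _ _).2.trans ?_)
    rw [hθy, ← Int.cast_add]
    have hgen : ∀ r ∈ Q, r ≠ q₀ → θ (.inl r) + θ (.inl (κ r)) = 0 := by
      intro r hr hrq
      have h1 := (hκ r (hQ hr)).2.2.1 hr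
      have h3 := (hκ r (hQ hr)).2.1
      have h4 : n r ≠ 0 := fun h => hrq (hninj _ hr _ hq₀ (h.trans hnq₀.symm))
      simp [θ, hr, h1, h3, h4]
    have : θ (.inl p) + θ (.inl (κ p)) = 0 := by
      by_cases hpQ : p ∈ Q
      · exact hgen p hpQ hpκ
      · have h1 := hgen (κ p) (hκQ p hp hpQ) (fun h => hpy (by rw [← h, (hκ p hp).2.1]))
        rw [(hκ p hp).2.1] at h1
        omega
    rw [this]; simp
  · refine hcinj _ (hc2 _ _).1 _ hyline ((hc2 _ _).2.trans ?_)
    rw [hθy, hκκ, ← Int.cast_add]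
    simp [θ, hq₀, hnq₀]

/-! ### Distinct representatives and dual hyperovals. -/

/-- Distinct representatives for sets with two elements (one of them may have only one element)
such that no element lies in more than two of the sets. -/
theorem exists_injective_of_two_le_card {ι α : Type*} [Fintype ι] [DecidableEq ι] [DecidableEq α]
    (t : ι → Finset α) (i₀ : ι) (hone : 1 ≤ (t i₀).card) (htwo : ∀ i, i ≠ i₀ → 2 ≤ (t i).card)
    (hle : ∀ x, (univ.filter fun i => x ∈ t i).card ≤ 2) :
    ∃ f : ι → α, Function.Injective f ∧ ∀ i, f i ∈ t i := by
  refine (all_card_le_biUnion_card_iff_exists_injective t).1 fun W => ?_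
  -- Hall's condition by double counting incidences: `2 * |W| - 1 ≤ ∑ |t i| ≤ 2 * |⋃ t i|`, and
  -- parity absorbs the `1`.
  have h1 := sum_card_bipartiteAbove_eq_sum_card_bipartiteBelow (s := W) (t := W.biUnion t)
    (fun i x => x ∈ t i)
  have h2 : ∑ x ∈ W.biUnion t, (W.bipartiteBelow (fun i x => x ∈ t i) x).card ≤
      (W.biUnion t).card * 2 := by
    rw [← smul_eq_mul]
    refine sum_le_card_nsmul _ _ _ fun x _ => (card_le_card ?_).trans (hle x)
    exact filter_subset_filter _ (subset_univ W)
  have h3 : ∀ i ∈ W, ((W.biUnion t).bipartiteAbove (fun i x => x ∈ t i) i) = t i := by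
    intro i hi
    ext x
    simp only [mem_bipartiteAbove, mem_biUnion]
    exact ⟨fun h => h.2, fun h => ⟨⟨i, hi, h⟩, h⟩⟩
  rw [sum_congr rfl fun i hi => congrArg card (h3 i hi)] at h1
  have h4 : W.card * 2 ≤ ∑ i ∈ W, (t i).card + 1 := by
    have h5 : ∀ i ∈ W, 2 ≤ (t i).card + if i = i₀ then 1 else 0 := by
      intro i _
      by_cases h : i = i₀
      · simp only [h, if_true]; omega
      · simp only [h, if_false]; exact htwo i h
    have h6 := card_nsmul_le_sum W _ 2 h5
    rw [sum_add_distrib, smul_eq_mul, sum_ite_eq'] at h6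
    split_ifs at h6 <;> omega
  omega

/-- The functions `φ s` whose level sets are the lines of the parallel class `s` of an affine
plane with point set `A`. -/
structure IsAffinePlane {I A F : Type*} (φ : I → A → F) : Prop where
  ext : ∀ {s t : I} {p r : A}, s ≠ t → φ s p = φ s r → φ t p = φ t r → p = r
  exists_point : ∀ {s t : I}, s ≠ t → ∀ b c, ∃ p, φ s p = b ∧ φ t p = c
  exists_slope : ∀ p r, ∃ s, φ s p = φ s r

/-- One line `b s` from each parallel class, such that each point of one of these lines is on
exactly two of them. Together with the line at infinity they form a dual hyperoval. -/
def IsDualHyperoval {I A F : Type*} (φ : I → A → F) (b : I → F) : Prop :=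
  ∀ p s, φ s p = b s → ∃! t, t ≠ s ∧ φ t p = b t

section

variable {I A F : Type*} {φ : I → A → F}

theorem IsAffinePlane.card_line [Fintype A] [Fintype F] [DecidableEq F] [Nontrivial I]
    (hφ : IsAffinePlane φ) (s : I) (b : F) :
    (univ.filter fun p => φ s p = b).card = Fintype.card F := by
  obtain ⟨t, ht⟩ := exists_ne s
  rw [← card_univ]
  refine card_bij (fun p _ => φ t p) (fun _ _ => mem_univ _) ?_ ?_
  · intro p hp r hr h
    rw [mem_filter] at hp hr
    exact hφ.ext ht h (hp.2.trans hr.2.symm)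
  · intro c _
    obtain ⟨p, hp, hpc⟩ := hφ.exists_point ht c b
    exact ⟨p, by simpa using hpc, hp⟩

open Classical in
/-- A further line through the same point at infinity as a line of a dual hyperoval has half of
its points on the lines of the dual hyperoval. -/
theorem IsDualHyperoval.two_mul_card [Fintype I] [Fintype A] [Fintype F]
    (hφ : IsAffinePlane φ) (hI : Fintype.card I = Fintype.card F + 1)
    {b : I → F} (hb : IsDualHyperoval φ b) {s : I} {c : F} (hc : c ≠ b s) :
    2 * (univ.filter fun p => φ s p = c ∧ ∃ t, t ≠ s ∧ φ t p = b t).card = Fintype.card F := by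
  have h1 := sum_card_bipartiteAbove_eq_sum_card_bipartiteBelow
    (s := univ.filter fun p => φ s p = c ∧ ∃ t, t ≠ s ∧ φ t p = b t)
    (t := univ.erase s) (fun p t => φ t p = b t)
  rw [sum_const_nat (m := 2), sum_const_nat (m := 1), card_erase_of_mem (mem_univ s),
    card_univ, hI] at h1
  · omega
  · intro t ht
    have hts : t ≠ s := ne_of_mem_erase ht
    obtain ⟨p, hp, hpt⟩ := hφ.exists_point hts (b t) c
    rw [card_eq_one]
    refine ⟨p, ?_⟩
    ext r
    simp only [mem_bipartiteBelow, mem_filter, mem_univ, true_and, mem_singleton]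
    constructor
    · rintro ⟨⟨hr, -⟩, hrt⟩
      exact hφ.ext hts (hrt.trans hp.symm) (hr.trans hpt.symm)
    · rintro rfl
      exact ⟨⟨hpt, t, hts, hp⟩, hp⟩
  · intro p hp
    simp only [mem_filter, mem_univ, true_and] at hp
    obtain ⟨hpc, t, hts, hpt⟩ := hp
    obtain ⟨t', ⟨htt', hpt'⟩, huniq⟩ := hb p t hpt
    rw [card_eq_two]
    refine ⟨t, t', htt'.symm, ?_⟩
    ext r
    simp only [mem_bipartiteAbove, mem_erase, mem_univ, and_true, mem_insert, mem_singleton]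
    constructor
    · rintro ⟨-, hr⟩
      by_cases h : r = t
      · exact Or.inl h
      · exact Or.inr (huniq r ⟨h, hr⟩)
    · rintro (rfl | rfl)
      · exact ⟨hts, hpt⟩
      · refine ⟨?_, hpt'⟩
        rintro rfl
        exact hc (hpc.symm.trans hpt')

open Classical in
/-- Let `part t` pair off the points of the line `b t` of a dual hyperoval for `t ≠ P`, and let `κ`
pair off the points of each line of the class `P`. All points but one point `y c` on
each line `c` of the class `P` own a pair that contains them, and none of the pairs
`y c, κ (y c)` is owned. -/
theorem IsDualHyperoval.exists_owned_pairs [Fintype A]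
    (hφ : IsAffinePlane φ) {b : I → F} (hb : IsDualHyperoval φ b) (P : I)
    (part : I → A → A) (hpart : ∀ t p, t ≠ P → φ t p = b t → part t p ≠ p ∧ φ t (part t p) = b t)
    (κ : A → A) (y : F → A) (hκκ : ∀ p, κ (κ p) = p) (hκne : ∀ p, κ p ≠ p)
    (hκφ : ∀ p, φ P (κ p) = φ P p)
    (hκD : ∀ p, φ P p ≠ b P →
      ((∃ t, t ≠ P ∧ φ t p = b t) ↔ ¬ ∃ t, t ≠ P ∧ φ t (κ p) = b t))
    (hyφ : ∀ c, φ P (y c) = c) (hyD : ∀ c, c ≠ b P → ¬ ∃ t, t ≠ P ∧ φ t (y c) = b t) :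
    ∃ a : A → A,
      (∀ p, p ≠ y (φ P p) → a p ≠ p ∧ ((p ≠ κ (y (φ P p)) ∧ a p = κ p) ∨
        ∃ t, t ≠ P ∧ φ t p = b t ∧ a p = part t p)) ∧
      ∀ p r, p ≠ y (φ P p) → r ≠ y (φ P r) → s(p, a p) = s(r, a r) → p = r := by
  let D : A → Prop := fun p => ∃ t, t ≠ P ∧ φ t p = b t
  have hDspecial : ∀ p, φ P p = b P → D p := fun p hp => (hb p P hp).exists
  -- Candidates for a point of `D`: off the line `b P` it is on two lines `b t` with `t ≠ P`; on `b
  -- P` it is on one, and its `κ`-pair is the second candidate. Only `κ (y (b P))` lacks a second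
  -- one, since that `κ`-pair is not to be owned.
  let R : A → A → Prop := fun p v => (∃ t, t ≠ P ∧ φ t p = b t ∧ v = part t p) ∨
    (φ P p = b P ∧ p ≠ κ (y (φ P p)) ∧ v = κ p)
  let T : {p // D p ∧ p ≠ y (φ P p)} → Finset (Sym2 A) := fun p =>
    univ.filter fun e => ∃ v, e = s(p.1, v) ∧ R p v
  have hTmem : ∀ p v, R p.1 v → s(p.1, v) ∈ T p := fun p v h =>
    mem_filter.2 ⟨mem_univ _, v, rfl, h⟩
  obtain ⟨a', ha'inj, ha'⟩ : ∃ f : {p // D p ∧ p ≠ y (φ P p)} → Sym2 A,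
      Function.Injective f ∧ ∀ i, f i ∈ T i := by
    have hi₀ : φ P (κ (y (b P))) = b P := (hκφ _).trans (hyφ _)
    refine exists_injective_of_two_le_card T ⟨κ (y (b P)), hDspecial _ hi₀, ?_⟩ ?_ ?_ ?_
    · rw [hi₀]; exact hκne _
    · obtain ⟨t, ht, hpt⟩ := hDspecial _ hi₀
      exact card_pos.2 ⟨_, hTmem ⟨κ (y (b P)), _⟩ _ (Or.inl ⟨t, ht, hpt, rfl⟩)⟩
    · rintro ⟨p, ⟨t, ht, hpt⟩, hpy⟩ hne
      have hcong : ∀ u v w : A, s(u, v) = s(u, w) → v = w := fun u v w h => Sym2.congr_right.1 h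
      suffices h : ∃ v w, R p v ∧ R p w ∧ v ≠ w by
        obtain ⟨v, w, hv, hw, hvw⟩ := h
        exact one_lt_card.2 ⟨_, hTmem ⟨p, _⟩ v hv, _, hTmem ⟨p, _⟩ w hw,
          fun h => hvw (hcong _ _ _ h)⟩
      obtain ⟨hne1, hon1⟩ := hpart t p ht hpt
      by_cases hp : φ P p = b P
      · refine ⟨part t p, κ p, Or.inl ⟨t, ht, hpt, rfl⟩, Or.inr ⟨hp, ?_, rfl⟩, fun h => ?_⟩
        · intro h
          apply hne
          rw [Subtype.mk.injEq, ← hp]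
          exact h
        · exact hne1 (hφ.ext ht (hon1.trans hpt.symm) (h ▸ hκφ p))
      · obtain ⟨t', ⟨htt', hpt'⟩, -⟩ := hb p t hpt
        have ht' : t' ≠ P := by rintro rfl; exact hp hpt'
        obtain ⟨hne2, hon2⟩ := hpart t' p ht' hpt'
        refine ⟨part t p, part t' p, Or.inl ⟨t, ht, hpt, rfl⟩, Or.inl ⟨t', ht', hpt', rfl⟩,
          fun h => hne1 (hφ.ext htt' (h ▸ hon2.trans hpt'.symm) (hon1.trans hpt.symm))⟩
    -- A pair can be a candidate only for its two ends.
    · intro e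
      refine (card_le_card_of_injOn (t := e.toFinset) Subtype.val ?_
        Subtype.val_injective.injOn).trans ?_
      · intro p hp
        obtain ⟨v, hv, -⟩ := (mem_filter.1 (mem_filter.1 hp).2).2
        simp [hv]
      · rw [Sym2.card_toFinset]
        split_ifs <;> omega
  have ha'' : ∀ p, ∃ v, a' p = s(p.1, v) ∧ R p.1 v := fun p => (mem_filter.1 (ha' p)).2
  choose g hg hgR using ha''
  refine ⟨fun p => if h : D p ∧ p ≠ y (φ P p) then g ⟨p, h⟩ else κ p, ?_, ?_⟩
  · intro p hp
    by_cases hD : D p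
    · simp only [hD, hp, ne_eq, not_false_eq_true, and_self, dif_pos]
      rcases hgR ⟨p, hD, hp⟩ with ⟨t, ht, hpt, h⟩ | ⟨h1, h2, h3⟩
      · rw [h]
        exact ⟨(hpart t p ht hpt).1, Or.inr ⟨t, ht, hpt, rfl⟩⟩
      · rw [h3]
        exact ⟨hκne p, Or.inl ⟨h2, rfl⟩⟩
    -- Points outside `D` own their `κ`-pair. Off the line `b P`, `κ` exchanges `D` with its
    -- complement, so no such pair is claimed twice.
    · simp only [hD, false_and, dif_neg, not_false_eq_true]
      refine ⟨hκne p, Or.inl ⟨fun h => ?_, trivial⟩⟩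
      have hns : φ P p ≠ b P := fun h' => hD (hDspecial p h')
      have h1 := (hκD p hns).not.1 hD
      rw [not_not, h, hκκ] at h1
      exact hyD _ hns h1
  · have hmix : ∀ p r, ∀ hp : D p ∧ p ≠ y (φ P p), ¬ D r → s(p, g ⟨p, hp⟩) ≠ s(r, κ r) := by
      intro p r hp hr h
      rw [Sym2.eq_iff] at h
      rcases h with ⟨rfl, -⟩ | ⟨h1, h2⟩
      · exact hr hp.1
      · rcases hgR ⟨p, hp⟩ with ⟨t, ht, hpt, h⟩ | ⟨h3, -, -⟩
        · rw [h2] at h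
          exact hr ⟨t, ht, h ▸ (hpart t p ht hpt).2⟩
        · apply hr
          apply hDspecial
          change φ P p = b P at h3
          rw [h1, hκφ] at h3
          exact h3
    intro p r hp hr h
    by_cases hDp : D p <;> by_cases hDr : D r
    · simp only [hDp, hp, hDr, hr, ne_eq, not_false_eq_true, and_self, dif_pos] at h
      have := hg ⟨p, hDp, hp⟩
      rw [h, ← hg ⟨r, hDr, hr⟩] at this
      simpa using ha'inj this
    · simp only [hDp, hp, hDr, ne_eq, not_false_eq_true, and_self, dif_pos, false_and,
        dif_neg] at h
      exact absurd h (hmix p r ⟨hDp, hp⟩ hDr)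
    · simp only [hDp, hr, hDr, ne_eq, not_false_eq_true, and_self, dif_pos, false_and,
        dif_neg] at h
      exact absurd h.symm (hmix r p ⟨hDr, hr⟩ hDp)
    · simp only [hDp, hDr, not_false_eq_true, false_and, dif_neg] at h
      rw [Sym2.eq_iff] at h
      rcases h with ⟨h, -⟩ | ⟨h1, h2⟩
      · exact h
      · have hns : φ P p ≠ b P := fun h' => hDp (hDspecial p h')
        have h3 := (hκD p hns).not.1 hDp
        rw [not_not, h2] at h3
        exact absurd h3 hDr

end

/-! ### Layered planes and the recolouring of affine pairs. -/

/-- An affine plane with points `A` and parallel classes `Option F`, together with a family `Λ` of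
dual hyperovals and of distinguished parallel classes `P`, and a near-one-factorization `c` of
each line. -/
structure LayeredPlane (F A Λ : Type*) where
  φ : Option F → A → F
  plane : IsAffinePlane φ
  P : Λ → Option F
  P_inj : Function.Injective P
  b : Λ → Option F → F
  hyperoval : ∀ l, IsDualHyperoval φ (b l)
  b_inj : ∀ s, Function.Injective fun l => b l s
  c : Option F → F → A ⊕ Option F → A ⊕ Option F → A ⊕ Option F
  κ : Option F → F → A → A
  y : Option F → F → A
  φ_y : ∀ s d, φ s (y s d) = d
  φ_κ : ∀ s d p, φ s p = d → φ s (κ s d p) = d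
  κ_κ : ∀ s d p, φ s p = d → κ s d (κ s d p) = p
  κ_ne : ∀ s d p, φ s p = d → κ s d p ≠ p
  c_symm : ∀ s d u v, c s d u v = c s d v u
  c_exists : ∀ s d u w, Sum.elim (φ s · = d) (· = s) u → Sum.elim (φ s · = d) (· = s) w → u ≠ w →
    ∃ v, Sum.elim (φ s · = d) (· = s) v ∧ v ≠ u ∧ c s d u v = w
  c_mem : ∀ s d u v, Sum.elim (φ s · = d) (· = s) u → Sum.elim (φ s · = d) (· = s) v → u ≠ v →
    Sum.elim (φ s · = d) (· = s) (c s d u v) ∧ c s d u v ≠ u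
  c_κ : ∀ s d p, φ s p = d → p ≠ y s d → p ≠ κ s d (y s d) →
    c s d (.inl p) (.inl (κ s d p)) = .inl (y s d)
  c_inf : ∀ s d, c s d (.inl (κ s d (y s d))) (.inr s) = .inl (y s d)
  split : ∀ l p, φ (P l) p ≠ b l (P l) → ((∃ t, t ≠ P l ∧ φ t p = b l t) ↔
    ¬ ∃ t, t ≠ P l ∧ φ t (κ (P l) (φ (P l) p) p) = b l t)
  not_mem_y : ∀ l d, d ≠ b l (P l) → ¬ ∃ t, t ≠ P l ∧ φ t (y (P l) d) = b l t

/-- The colours: the flags `aff p s` and `par s d` of the lines of the affine plane at an affine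
point and at the point at infinity, the flags `inf s` of the line at infinity, and `|F|` more
colours. -/
inductive LayeredPlane.Colour (F A : Type*) where
  | aff (p : A) (s : Option F)
  | par (s : Option F) (d : F)
  | inf (s : Option F)
  | sig (σ : F)

open LayeredPlane.Colour

/-- On a line of a distinguished class other than `b l (P l)`, the half exchanged by `κ` is the set
of points on the dual hyperoval, which `IsDualHyperoval.two_mul_card` shows to be half of the line.
Injectivity of `P` makes this choice unambiguous; on all other lines any half will do. -/
theorem exists_layeredPlane {F A Λ : Type*} [Fintype F] [Fintype A]
    (hF : Even (Fintype.card F)) [Nonempty F]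
    (φ : Option F → A → F) (hφ : IsAffinePlane φ) (P : Λ → Option F) (hP : Function.Injective P)
    (b : Λ → Option F → F) (hb : ∀ l, IsDualHyperoval φ (b l))
    (hbinj : ∀ s, Function.Injective fun l => b l s) :
    ∃ D : LayeredPlane F A Λ, D.P = P := by
  classical
  have hline : ∀ s d, (univ.filter fun p => φ s p = d).card = Fintype.card F := hφ.card_line
  have hQ : ∀ s d, ∃ Q ⊆ univ.filter (fun p => φ s p = d),
      2 * Q.card = (univ.filter fun p => φ s p = d).card ∧
      ∀ l, P l = s → d ≠ b l s →
        Q = univ.filter fun p => φ s p = d ∧ ∃ t, t ≠ s ∧ φ t p = b l t := by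
    intro s d
    by_cases h : ∃ l, P l = s ∧ d ≠ b l s
    · obtain ⟨l, rfl, hl⟩ := h
      refine ⟨univ.filter fun p => φ (P l) p = d ∧ ∃ t, t ≠ P l ∧ φ t p = b l t,
        fun p hp => ?_, ?_, fun m hm _ => ?_⟩
      · simp only [mem_filter, mem_univ, true_and] at hp ⊢
        exact hp.1
      · rw [hline]
        convert (hb l).two_mul_card hφ (by simp) hl
      · rw [hP hm]
    · obtain ⟨n, hn⟩ := hF
      obtain ⟨Q, hQ, hQc⟩ := exists_subset_card_eq
        (s := univ.filter fun p => φ s p = d) (n := n) (by rw [hline, hn]; omega)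
      exact ⟨Q, hQ, by rw [hQc, hline]; omega, fun l hl hd => absurd ⟨l, hl, hd⟩ h⟩
  choose Q hQL hQc hQD using hQ
  have hQne : ∀ s d, (Q s d).Nonempty := by
    intro s d
    have := hQc s d
    rw [hline] at this
    have h0 := Fintype.card_pos (α := F)
    exact card_pos.1 (by omega)
  have hnf := fun s d => exists_nearFactorization _ (Q s d) s (hQL s d) (hQc s d) (hQne s d)
  choose c κ y hyL hyQ hκ hcs hce hcm hcκ hci using hnf
  simp only [mem_filter, mem_univ, true_and] at hyL hκ hcκ
  have hmem : ∀ s d (x : A ⊕ Option F), x ∈ (univ.filter fun p => φ s p = d).disjSum {s} ↔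
      Sum.elim (φ s · = d) (· = s) x := by
    rintro s d (p | t) <;> simp
  simp only [hmem] at hce hcm
  have hQmem : ∀ l d p, d ≠ b l (P l) → φ (P l) p = d →
      (p ∈ Q (P l) d ↔ ∃ t, t ≠ P l ∧ φ t p = b l t) := by
    intro l d p hd hp
    rw [hQD _ _ l rfl hd]
    simp [hp]
  refine ⟨⟨φ, hφ, P, hP, b, hb, hbinj, c, κ, y, hyL, fun s d p hp => (hκ s d p hp).1,
    fun s d p hp => (hκ s d p hp).2.1, fun s d p hp h => ?_, hcs,
    fun s d u w hu => hce s d u hu w, fun s d u v hu => hcm s d u hu v, hcκ, hci,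
    fun l p hp => ?_, fun l d hd h => hyQ _ _ ((hQmem l d _ hd (hyL _ _)).2 h)⟩, rfl⟩
  · have := (hκ s d p hp).2.2
    rw [h] at this
    tauto
  · rw [← hQmem l _ p hp rfl, (hκ _ _ p rfl).2.2, hQmem l _ _ hp (hκ _ _ p rfl).1]

namespace LayeredPlane

variable {F A Λ : Type*} (D : LayeredPlane F A Λ)

/-- The flags of layer `l` whose classes are dissolved. -/
def Dissolved (l : Λ) (X : Colour F A) : Prop :=
  (∃ d, X = aff (D.y (D.P l) d) (D.P l)) ∨ ∃ s, s ≠ D.P l ∧ X = par s (D.b l s)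

/-- Layers differ in `P l` and in every intercept `b l s`, so a freed edge belongs to one layer
only. -/
theorem Dissolved.unique {D : LayeredPlane F A Λ} {l m : Λ} {X : Colour F A}
    (hl : D.Dissolved l X) (hm : D.Dissolved m X) : l = m := by
  rcases hl with ⟨d, rfl⟩ | ⟨s, -, rfl⟩ <;> rcases hm with ⟨d', h⟩ | ⟨s', -, h⟩
  · simp only [aff.injEq] at h
    exact D.P_inj h.2
  · simp at h
  · simp at h
  · simp only [par.injEq] at h
    obtain ⟨rfl, h⟩ := h
    exact D.b_inj _ h

/-- The colour of the class of the line `(s, d)` that misses the point `x`. -/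
def flag (s : Option F) (d : F) : A ⊕ Option F → Colour F A
  | .inl p => aff p s
  | .inr _ => par s d

theorem exists_label : ∃ lab : A → A → Colour F A, (∀ u v, lab u v = lab v u) ∧
    ∀ u v s, u ≠ v → D.φ s u = D.φ s v →
      lab u v = flag s (D.φ s u) (D.c s (D.φ s u) (.inl u) (.inl v)) := by
  choose sl hsl using D.plane.exists_slope
  have key : ∀ u v s, u ≠ v → D.φ s u = D.φ s v → sl u v = s := by
    intro u v s huv h
    by_contra hne
    exact huv (D.plane.ext hne (hsl u v) h)
  refine ⟨fun u v => flag (sl u v) (D.φ (sl u v) u)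
    (D.c (sl u v) (D.φ (sl u v) u) (.inl u) (.inl v)), ?_, ?_⟩
  · intro u v
    beta_reduce
    by_cases h : u = v
    · rw [h]
    · rw [key v u (sl u v) (Ne.symm h) (hsl u v).symm, hsl u v, D.c_symm]
  · intro u v s huv h
    beta_reduce
    rw [key u v s huv h]

/-- The class that misses the infinite point of a line matches its affine points perfectly; on dual
hyperoval lines these are the pairs that can be owned. -/
theorem exists_partner (s : Option F) (d : F) (p : A) (hp : D.φ s p = d) :
    ∃ v, v ≠ p ∧ D.φ s v = d ∧ D.c s d (.inl p) (.inl v) = .inr s := by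
  obtain ⟨v, hv, hvp, hc⟩ := D.c_exists s d (.inl p) (.inr s) hp rfl (by simp)
  rcases v with v | t
  · exact ⟨v, fun h => hvp (by rw [h]), hv, hc⟩
  · obtain rfl : t = s := hv
    have := (D.c_mem t d (.inr t) (.inl p) rfl hp (by simp)).2
    rw [D.c_symm, hc] at this
    exact absurd rfl this

/-- A colouring of the pairs of affine points: pairs in a class that is not dissolved
keep their colour, and each affine point `p` is on a pair with the colour `aff p (P l)`
unless the class of this flag is dissolved. -/
theorem exists_affine_colouring [Fintype A] : ∃ lab col : A → A → Colour F A,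
    (∀ u v s, u ≠ v → D.φ s u = D.φ s v →
      lab u v = flag s (D.φ s u) (D.c s (D.φ s u) (.inl u) (.inl v))) ∧
    (∀ u v, col u v = col v u) ∧
    (∀ u v, (∀ l, ¬ D.Dissolved l (lab u v)) → col u v = lab u v) ∧
    ∀ l p, p ≠ D.y (D.P l) (D.φ (D.P l) p) → ∃ v, v ≠ p ∧ col p v = aff p (D.P l) := by
  classical
  obtain ⟨lab, hlabs, hlab⟩ := D.exists_label
  have hown : ∀ l, ∃ a : A → A,
      (∀ p, p ≠ D.y (D.P l) (D.φ (D.P l) p) → a p ≠ p ∧ D.Dissolved l (lab p (a p))) ∧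
      ∀ p r, p ≠ D.y (D.P l) (D.φ (D.P l) p) → r ≠ D.y (D.P l) (D.φ (D.P l) r) →
        s(p, a p) = s(r, a r) → p = r := by
    intro l
    have hpart : ∀ t p, ∃ v, D.φ t p = D.b l t → v ≠ p ∧ D.φ t v = D.b l t ∧
        D.c t (D.b l t) (.inl p) (.inl v) = .inr t := by
      intro t p
      by_cases h : D.φ t p = D.b l t
      · obtain ⟨v, hv⟩ := D.exists_partner t _ p h
        exact ⟨v, fun _ => hv⟩
      · exact ⟨p, fun h' => absurd h' h⟩
    choose part hpart using hpart
    obtain ⟨a, ha, hainj⟩ := (D.hyperoval l).exists_owned_pairs D.plane (D.P l) part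
      (fun t p _ h => ⟨(hpart t p h).1, (hpart t p h).2.1⟩)
      (fun p => D.κ (D.P l) (D.φ (D.P l) p) p) (D.y (D.P l))
      (fun p => by
        rw [D.φ_κ _ _ p rfl, D.κ_κ _ _ p rfl])
      (fun p => D.κ_ne _ _ p rfl) (fun p => D.φ_κ _ _ p rfl) (fun p hp => D.split l p hp)
      (fun d => D.φ_y _ d) (fun d hd => D.not_mem_y l d hd)
    refine ⟨a, fun p hp => ⟨(ha p hp).1, ?_⟩, hainj⟩
    rcases (ha p hp).2 with ⟨h1, h2⟩ | ⟨t, ht, hpt, h2⟩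
    · rw [D.φ_y] at h1
      refine Or.inl ⟨D.φ (D.P l) p, ?_⟩
      rw [hlab p (a p) (D.P l) (ha p hp).1.symm (by rw [h2, D.φ_κ _ _ p rfl]), h2,
        D.c_κ _ _ p rfl hp h1]
      rfl
    · refine Or.inr ⟨t, ht, ?_⟩
      rw [hlab p (a p) t (ha p hp).1.symm (by rw [h2, (hpart t p hpt).2.1, hpt]), h2, hpt,
        (hpart t p hpt).2.2]
      rfl
  choose own hownD howninj using hown
  let lab' : Sym2 A → Colour F A := Sym2.lift ⟨lab, hlabs⟩
  let Owns : Sym2 A → Λ × A → Prop := fun e x =>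
    x.2 ≠ D.y (D.P x.1) (D.φ (D.P x.1) x.2) ∧ e = s(x.2, own x.1 x.2)
  have howns : ∀ e x x', Owns e x → Owns e x' → x = x' := by
    rintro e ⟨l, p⟩ ⟨m, r⟩ ⟨h1, h2⟩ ⟨h3, h4⟩
    have hl : D.Dissolved l (lab' e) := by rw [h2]; exact (hownD l p h1).2
    have hm : D.Dissolved m (lab' e) := by rw [h4]; exact (hownD m r h3).2
    obtain rfl := hl.unique hm
    rw [howninj l p r h1 h3 (h2.symm.trans h4)]
  let col : Sym2 A → Colour F A := fun e =>
    if h : ∃ x, Owns e x then aff h.choose.2 (D.P h.choose.1) else lab' e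
  have hcol : ∀ e x, Owns e x → col e = aff x.2 (D.P x.1) := by
    intro e x hx
    have h : ∃ x, Owns e x := ⟨x, hx⟩
    simp only [col, h, dif_pos]
    rw [howns e _ _ h.choose_spec hx]
  refine ⟨lab, fun u v => col s(u, v), hlab, fun u v => congrArg col Sym2.eq_swap, ?_, ?_⟩
  · intro u v h
    have : ¬ ∃ x, Owns s(u, v) x := by
      rintro ⟨⟨l, p⟩, h1, h2⟩
      refine h l ?_
      have : D.Dissolved l (lab' s(u, v)) := by rw [h2]; exact (hownD l p h1).2
      exact this
    simp only [col, this, dif_neg, not_false_eq_true]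
    rfl
  · intro l p hp
    exact ⟨own l p, (hownD l p hp).1, hcol _ (l, p) ⟨hp, rfl⟩⟩

end LayeredPlane

/-! ### Counting colours, and filling the edges at infinite points. -/

namespace LayeredPlane

open Colour

variable {F A Λ : Type*}

/-- The colours as a disjoint sum. -/
def Colour.equivSum (F A : Type*) :
    Colour F A ≃ (A × Option F) ⊕ (Option F × F) ⊕ Option F ⊕ F where
  toFun X := match X with
    | aff p s => .inl (p, s)
    | par s d => .inr (.inl (s, d))
    | inf s => .inr (.inr (.inl s))
    | sig σ => .inr (.inr (.inr σ))
  invFun x := match x with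
    | .inl (p, s) => aff p s
    | .inr (.inl (s, d)) => par s d
    | .inr (.inr (.inl s)) => inf s
    | .inr (.inr (.inr σ)) => sig σ
  left_inv := by rintro (_ | _ | _ | _) <;> rfl
  right_inv := by rintro (_ | _ | _ | _) <;> rfl

instance [Fintype F] [Fintype A] : Fintype (Colour F A) :=
  Fintype.ofEquiv _ (Colour.equivSum F A).symm

theorem Colour.card [Fintype F] [Fintype A] : Fintype.card (Colour F A) =
    Fintype.card A * (Fintype.card F + 1) + ((Fintype.card F + 1) * Fintype.card F +
      ((Fintype.card F + 1) + Fintype.card F)) := by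
  rw [Fintype.card_congr (Colour.equivSum F A)]
  simp

variable (D : LayeredPlane F A Λ)

/-- The colours that are used. -/
def Used [Zero F] (X : Colour F A) : Prop := (∀ l, ¬ D.Dissolved l X) ∧ X ≠ sig 0

open Classical in
theorem card_used [Zero F] [Fintype F] [Fintype A] [Fintype Λ]
    (hA : Fintype.card A = Fintype.card F ^ 2) :
    (univ.filter D.Used).card + 2 * Fintype.card F * Fintype.card Λ =
      Fintype.card F ^ 3 + 2 * Fintype.card F ^ 2 + 3 * Fintype.card F := by
  let f : (Λ × F) ⊕ (Σ l : Λ, {s // s ≠ D.P l}) ⊕ Unit → Colour F A := fun x => match x with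
    | .inl (l, d) => aff (D.y (D.P l) d) (D.P l)
    | .inr (.inl ⟨l, s⟩) => par s (D.b l s)
    | .inr (.inr _) => sig 0
  have hf : Function.Injective f := by
    rintro (⟨l, d⟩ | ⟨l, s, hs⟩ | _) (⟨m, d'⟩ | ⟨m, s', hs'⟩ | _) h <;> simp only [f] at h <;>
      try cases h
    · simp only [aff.injEq] at h
      obtain rfl := D.P_inj h.2
      have := congrArg (D.φ (D.P l)) h.1
      rw [D.φ_y, D.φ_y] at this
      rw [this]
    · simp only [par.injEq] at h
      obtain ⟨rfl, h⟩ := h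
      obtain rfl := D.b_inj _ h
      rfl
    · rfl
  have himg : univ.image f = (univ.filter D.Used)ᶜ := by
    ext X
    simp only [mem_image, mem_univ, true_and, mem_compl, mem_filter, Used, not_and_or, not_forall,
      not_not]
    constructor
    · rintro ⟨⟨l, d⟩ | ⟨l, s, hs⟩ | _, rfl⟩
      · exact Or.inl ⟨l, Or.inl ⟨d, rfl⟩⟩
      · exact Or.inl ⟨l, Or.inr ⟨s, hs, rfl⟩⟩
      · exact Or.inr rfl
    · rintro (⟨l, ⟨d, rfl⟩ | ⟨s, hs, rfl⟩⟩ | rfl)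
      · exact ⟨.inl (l, d), rfl⟩
      · exact ⟨.inr (.inl ⟨l, s, hs⟩), rfl⟩
      · exact ⟨.inr (.inr ()), rfl⟩
  have h1 := card_image_of_injective univ hf
  rw [himg, card_compl, card_univ, Colour.card, hA] at h1
  have h2 : (univ.filter D.Used).card ≤ Fintype.card (Colour F A) := card_le_univ _
  rw [Colour.card, hA] at h2
  have h3 : Fintype.card ((Λ × F) ⊕ (Σ l : Λ, {s // s ≠ D.P l}) ⊕ Unit) =
      Fintype.card Λ * Fintype.card F + (Fintype.card Λ * Fintype.card F + 1) := by
    simp [Fintype.card_subtype_compl]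
  rw [h3] at h1
  generalize Fintype.card F = q at *
  generalize Fintype.card Λ = n at *
  zify [h2] at h1
  zify
  linear_combination -h1

open Classical in
theorem card_par [Fintype F] [Fintype Λ] (s : Option F) :
    (univ.filter fun d => ∀ l, ¬ D.Dissolved l (par s d)).card +
      (univ.filter fun l => D.P l ≠ s).card = Fintype.card F := by
  have h : (univ.filter fun d => ∀ l, ¬ D.Dissolved l (par s d))ᶜ =
      (univ.filter fun l => D.P l ≠ s).image fun l => D.b l s := by
    ext d
    simp only [mem_compl, mem_filter, mem_univ, true_and, not_forall, not_not, mem_image]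
    constructor
    · rintro ⟨l, ⟨d', h⟩ | ⟨t, ht, h⟩⟩
      · cases h
      · simp only [par.injEq] at h
        obtain ⟨rfl, rfl⟩ := h
        exact ⟨l, ht.symm, rfl⟩
    · rintro ⟨l, hl, rfl⟩
      exact ⟨l, Or.inr ⟨s, Ne.symm hl, rfl⟩⟩
  rw [← card_image_of_injective _ (D.b_inj s), ← h, card_compl]
  have := card_le_univ (univ.filter fun d => ∀ l, ¬ D.Dissolved l (par s d))
  omega

/-- The further vertices: one for each parallel class that is not distinguished. -/
abbrev Extra : Type _ := {s // s ∉ Set.range D.P}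

open Classical in
theorem card_extra [Fintype F] [Fintype Λ] :
    Fintype.card D.Extra + Fintype.card Λ = Fintype.card F + 1 := by
  have h1 := Fintype.card_subtype_compl (fun s => s ∈ Set.range D.P)
  have h2 : Fintype.card {s // s ∈ Set.range D.P} = Fintype.card Λ :=
    Set.card_range_of_injective D.P_inj
  have h3 : Fintype.card {s // s ∈ Set.range D.P} ≤ Fintype.card (Option F) :=
    Fintype.card_subtype_le _
  rw [h2] at h1 h3
  rw [Fintype.card_option] at h1 h3
  change Fintype.card D.Extra = _ at h1
  omega

open Classical in
-- The numbers fit exactly: each layer dissolves one flag `par s d`, leaving `q - N`, and with `inf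
-- s` they match the `q + 1 - N` edges from the infinite point `s` to the extra vertices.
theorem exists_extra_colouring [Fintype F] [Fintype A] [Fintype Λ] (s : Option F)
    (hs : s ∉ Set.range D.P) :
    ∃ f : D.Extra → Colour F A, (∀ d, (∀ l, ¬ D.Dissolved l (par s d)) → ∃ e, f e = par s d) ∧
      ∃ e, f e = inf s := by
  let T : Finset (Colour F A) := insert (inf s)
    ((univ.filter fun d => ∀ l, ¬ D.Dissolved l (par s d)).image fun d => par s d)
  have hT : Fintype.card D.Extra = T.card := by
    have h1 := D.card_par s
    have h2 := D.card_extra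
    rw [filter_true_of_mem (p := fun l => D.P l ≠ s) (fun l _ h => hs ⟨l, h⟩), card_univ] at h1
    rw [card_insert_of_notMem (by simp), card_image_of_injective _ (fun a b h => by simpa using h)]
    omega
  obtain ⟨g, -⟩ := exists_equiv_extend_of_card_eq (s := ∅) (f := fun _ => inf s) hT (by simp)
    (by simp)
  have hg : ∀ X ∈ T, ∃ e, (g e : Colour F A) = X := fun X hX => ⟨g.symm ⟨X, hX⟩, by simp⟩
  refine ⟨fun e => g e, fun d hd => hg _ ?_, hg _ (mem_insert_self _ _)⟩
  exact mem_insert_of_mem (mem_image.2 ⟨d, by simpa using hd, rfl⟩)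

open Classical in
-- Here the `q + 1 - N` edges to extra vertices and `q` freed edges carry the `q - N + 1` flags
-- `par`, the flag `inf` and the `q - 1` nonzero `sig` colours. The values `sig (x + z)` are
-- prescribed because the extra vertex `z` must see that colour on its edge to the distinguished
-- point `x`.
theorem exists_pool [Field F] [CharP F 2] [Fintype F] [Fintype A] [Fintype Λ] (m : Λ) :
    ∃ f : D.Extra ⊕ F → Colour F A,
      (∀ (e : D.Extra) x z, D.P m = some x → e.1 = some z → f (.inl e) = sig (x + z)) ∧
      (∀ σ, σ ≠ 0 → ∃ i, f i = sig σ) ∧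
      (∀ d, (∀ l, ¬ D.Dissolved l (par (D.P m) d)) → ∃ i, f i = par (D.P m) d) ∧
      ∃ i, f i = inf (D.P m) := by
  let T₁ : Finset (Colour F A) := (univ.erase 0).image sig
  let T₂ : Finset (Colour F A) :=
    (univ.filter fun d => ∀ l, ¬ D.Dissolved l (par (D.P m) d)).image fun d => par (D.P m) d
  let T : Finset (Colour F A) := insert (inf (D.P m)) (T₁ ∪ T₂)
  have hT : Fintype.card (D.Extra ⊕ F) = T.card := by
    have h1 := D.card_par (D.P m)
    have h2 := D.card_extra
    have h3 : (univ.filter fun l => D.P l ≠ D.P m) = univ.erase m := by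
      ext l
      simp [D.P_inj.eq_iff]
    have h4 : 0 < Fintype.card Λ := Fintype.card_pos_iff.2 ⟨m⟩
    have h5 : 0 < Fintype.card F := Fintype.card_pos
    rw [h3, card_erase_of_mem (mem_univ m), card_univ] at h1
    rw [card_insert_of_notMem (by simp [T₁, T₂]), card_union_of_disjoint,
      card_image_of_injective _ (fun a b h => by simpa using h),
      card_image_of_injective _ (fun a b h => by simpa using h), card_erase_of_mem (mem_univ _),
      card_univ, Fintype.card_sum]
    · omega
    · rw [disjoint_left]
      intro X hX hX'
      obtain ⟨σ, -, rfl⟩ := mem_image.1 hX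
      obtain ⟨d, -, h⟩ := mem_image.1 hX'
      cases h
  let S : Finset (D.Extra ⊕ F) := univ.filter fun i =>
    ∃ (e : D.Extra) (x z : F), i = .inl e ∧ D.P m = some x ∧ e.1 = some z
  let f₀ : D.Extra ⊕ F → Colour F A :=
    Sum.elim (fun e => sig ((D.P m).getD 0 + e.1.getD 0)) (fun _ => inf (D.P m))
  obtain ⟨g, hg'⟩ := exists_equiv_extend_of_card_eq (s := S) (f := f₀) hT (by
      intro X hX
      obtain ⟨i, hi, rfl⟩ := mem_image.1 hX
      obtain ⟨e, x, z, rfl, hx, hz⟩ := (mem_filter.1 hi).2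
      refine mem_insert_of_mem (mem_union_left _ (mem_image.2 ⟨x + z, ?_, ?_⟩))
      · rw [mem_erase]
        refine ⟨fun h => e.2 ⟨m, ?_⟩, mem_univ _⟩
        rw [hx, hz, CharTwo.add_eq_zero.1 h]
      · simp [f₀, hx, hz]) (by
      intro i hi j hj hij
      obtain ⟨e, x, z, rfl, hx, hz⟩ := (mem_filter.1 hi).2
      obtain ⟨e', x', z', rfl, hx', hz'⟩ := (mem_filter.1 hj).2
      simp only [f₀, Sum.elim_inl, hz, hz', sig.injEq, add_right_inj, Option.getD_some] at hij
      congr 1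
      exact Subtype.ext (by rw [hz, hz', hij]))
  have hg : ∀ X ∈ T, ∃ i, (g i : Colour F A) = X := fun X hX => ⟨g.symm ⟨X, hX⟩, by simp⟩
  refine ⟨fun i => g i, fun e x z hx hz => ?_, fun σ hσ => hg _ ?_, fun d hd => hg _ ?_,
    hg _ (mem_insert_self _ _)⟩
  · beta_reduce
    rw [hg' _ (mem_filter.2 ⟨mem_univ _, e, x, z, rfl, hx, hz⟩)]
    simp [f₀, hx, hz]
  · exact mem_insert_of_mem (mem_union_left _ (mem_image.2 ⟨σ, by simp [hσ], rfl⟩))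
  · exact mem_insert_of_mem (mem_union_right _ (mem_image.2 ⟨d, by simpa using hd, rfl⟩))

end LayeredPlane

/-- A near-one-factorization of the complete graph on an odd number of vertices. -/
theorem exists_nearFactorization_univ {X : Type*} [Fintype X] (hX : Odd (Fintype.card X)) :
    ∃ c : X → X → X, (∀ u v, c u v = c v u) ∧ ∀ u w, u ≠ w → ∃ v, v ≠ u ∧ c u v = w := by
  obtain ⟨h, hh⟩ := hX
  have e : X ≃ ZMod (2 * h + 1) := Fintype.equivOfCardEq (by rw [hh, ZMod.card])
  obtain ⟨c, hc, hc2, hc3⟩ := exists_midpoint univ e e.injective.injOn (by rw [card_univ, hh])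
  have h2 : ∀ u v, 2 * e u = 2 * e v → u = v := by
    intro u v huv
    apply e.injective
    have : ((2 * h + 1 : ℕ) : ZMod (2 * h + 1)) = 0 := ZMod.natCast_self _
    push_cast at this
    linear_combination (h + 1) * huv - (e u - e v) * this
  refine ⟨c, hc, fun u w huw => ?_⟩
  obtain ⟨v, -, hv⟩ := hc3 u (mem_univ _) w (mem_univ _)
  refine ⟨v, fun h => huw (h2 _ _ ?_), h2 _ _ ((hc2 u v).2.trans hv)⟩
  rw [h] at hv
  linear_combination hv

/-! ### The complete colouring. -/

namespace LayeredPlane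

open Colour

variable {F A Λ : Type*} (D : LayeredPlane F A Λ)

/-- A colouring of the pairs of points of the projective plane and further vertices, such that
any two used colours occur at a common vertex. -/
theorem exists_complete_colouring [Field F] [CharP F 2] [Fintype F] [Fintype A] [Fintype Λ]
    (hnone : IsEmpty Λ ∨ none ∈ Set.range D.P) (hF : Even (Fintype.card F)) :
    ∃ col : A ⊕ Option F ⊕ D.Extra → A ⊕ Option F ⊕ D.Extra → Colour F A,
      (∀ u v, col u v = col v u) ∧
      ∀ X, D.Used X → ∀ Y, D.Used Y → X ≠ Y →
        ∃ u, (∃ v, v ≠ u ∧ col u v = X) ∧ ∃ v, v ≠ u ∧ col u v = Y := by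
  classical
  obtain ⟨lab, cAA, hlab, hAAs, hAA, hAAown⟩ := D.exists_affine_colouring
  obtain ⟨c₀, hc₀s, hc₀⟩ := exists_nearFactorization_univ (X := Option F)
    (by rw [Fintype.card_option]; exact hF.add_one)
  choose pool hpoolE hpoolσ hpoolpar hpoolinf using D.exists_pool
  have hext : ∀ s, ∃ f : D.Extra → Colour F A, s ∉ Set.range D.P →
      (∀ d, (∀ l, ¬ D.Dissolved l (par s d)) → ∃ e, f e = par s d) ∧ ∃ e, f e = inf s := by
    intro s
    by_cases h : s ∈ Set.range D.P
    · exact ⟨fun _ => inf s, fun h' => absurd h h'⟩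
    · obtain ⟨f, hf⟩ := D.exists_extra_colouring s h
      exact ⟨f, fun _ => hf⟩
  choose ext hext using hext
  -- The freed edges at the infinite point of a distinguished class join it to the points `κ y`.
  let free : A → Option F → Λ → Prop := fun u s l =>
    D.P l = s ∧ u = D.κ s (D.φ s u) (D.y s (D.φ s u))
  let cAI : A → Option F → Colour F A := fun u s =>
    if h : ∃ l, free u s l then pool h.choose (.inr (D.φ s u)) else
      flag s (D.φ s u) (D.c s (D.φ s u) (.inl u) (.inr s))
  have hAIpool : ∀ l d, cAI (D.κ (D.P l) d (D.y (D.P l) d)) (D.P l) = pool l (.inr d) := by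
    intro l d
    have hφ : D.φ (D.P l) (D.κ (D.P l) d (D.y (D.P l) d)) = d := D.φ_κ _ _ _ (D.φ_y _ _)
    have h : ∃ m, free (D.κ (D.P l) d (D.y (D.P l) d)) (D.P l) m := ⟨l, rfl, by rw [hφ]⟩
    simp only [cAI, h, dif_pos]
    rw [D.P_inj h.choose_spec.1, hφ]
  have hAI : ∀ u s, (∀ l, ¬ D.Dissolved l (flag s (D.φ s u) (D.c s (D.φ s u) (.inl u) (.inr s)))) →
      cAI u s = flag s (D.φ s u) (D.c s (D.φ s u) (.inl u) (.inr s)) := by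
    intro u s hu
    have h : ¬ ∃ m, free u s m := by
      rintro ⟨l, rfl, h⟩
      apply hu l
      left
      refine ⟨D.φ (D.P l) u, ?_⟩
      have := D.c_inf (D.P l) (D.φ (D.P l) u)
      rw [← h] at this
      rw [this]
      rfl
    simp only [cAI, h, dif_neg, not_false_eq_true]
  let cIE : Option F → D.Extra → Colour F A := fun s e =>
    if h : s ∈ Set.range D.P then pool h.choose (.inl e) else ext s e
  have hIEpool : ∀ l e, cIE (D.P l) e = pool l (.inl e) := by
    intro l e
    have h : D.P l ∈ Set.range D.P := ⟨l, rfl⟩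
    simp only [cIE, h, dif_pos]
    rw [D.P_inj h.choose_spec]
  have hIEext : ∀ s e, s ∉ Set.range D.P → cIE s e = ext s e := by
    intro s e h
    simp only [cIE, h, dif_neg, not_false_eq_true]
  let col : A ⊕ Option F ⊕ D.Extra → A ⊕ Option F ⊕ D.Extra → Colour F A := fun u v =>
    match u, v with
    | .inl u, .inl v => cAA u v
    | .inl u, .inr (.inl s) => cAI u s
    | .inl u, .inr (.inr e) => aff u e.1
    | .inr (.inl s), .inl u => cAI u s
    | .inr (.inl s), .inr (.inl t) => inf (c₀ s t)
    | .inr (.inl s), .inr (.inr e) => cIE s e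
    | .inr (.inr e), .inl u => aff u e.1
    | .inr (.inr e), .inr (.inl s) => cIE s e
    | .inr (.inr e), .inr (.inr e') => sig (e.1.getD 0 + e'.1.getD 0)
  have hcols : ∀ u v, col u v = col v u := by
    rintro (u | s | e) (v | t | e')
    · exact hAAs u v
    · rfl
    · rfl
    · rfl
    · exact congrArg inf (hc₀s s t)
    · rfl
    · rfl
    · rfl
    · exact congrArg sig (add_comm _ _)
  refine ⟨col, hcols, ?_⟩
  let Cov : Colour F A → A ⊕ Option F ⊕ D.Extra → Prop := fun X u => ∃ v, v ≠ u ∧ col u v = X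
  change ∀ X, D.Used X → ∀ Y, D.Used Y → X ≠ Y → ∃ u, Cov X u ∧ Cov Y u
  have hpool : ∀ l i, ∃ v, v ≠ .inr (.inl (D.P l)) ∧ col (.inr (.inl (D.P l))) v = pool l i := by
    rintro l (e | d)
    · exact ⟨.inr (.inr e), by simp, hIEpool l e⟩
    · exact ⟨.inl (D.κ (D.P l) d (D.y (D.P l) d)), by simp, hAIpool l d⟩
  let emb : A ⊕ Option F → A ⊕ Option F ⊕ D.Extra := Sum.map id .inl
  have hbase : ∀ s d u w, Sum.elim (D.φ s · = d) (· = s) u → Sum.elim (D.φ s · = d) (· = s) w →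
      u ≠ w → (∀ l, ¬ D.Dissolved l (flag s d w)) → Cov (flag s d w) (emb u) := by
    intro s d u w hu hw huw hX
    obtain ⟨v, hv, hvu, rfl⟩ := D.c_exists s d u w hu hw huw
    refine ⟨emb v, ?_, ?_⟩
    · intro h
      exact hvu ((Sum.map_injective.2 ⟨Function.injective_id, Sum.inl_injective⟩) h)
    · rcases u with u | t <;> rcases v with v | t'
      · obtain rfl : D.φ s u = d := hu
        have hne : u ≠ v := fun h => hvu (by rw [h])
        have h := hlab u v s hne hv.symm
        rw [← h] at hX ⊢
        exact hAA u v hX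
      · obtain rfl : D.φ s u = d := hu
        obtain rfl : t' = s := hv
        exact hAI u t' hX
      · obtain rfl : D.φ s v = d := hv
        obtain rfl : t = s := hu
        rw [D.c_symm] at hX ⊢
        exact hAI v t hX
      · obtain rfl : t = s := hu
        obtain rfl : t' = t := hv
        exact absurd rfl hvu
  -- What each kind of colour covers. An `Aff` colour reaches the whole line, an `Inf` colour the
  -- whole line at infinity, a `Sig` colour all distinguished infinite points and all extra
  -- vertices. The extra-vertex clauses serve to meet `Sig` colours when the class is not
  -- distinguished.
  let Aff : Colour F A → Prop := fun X => ∃ s d, (∀ u, D.φ s u = d → Cov X (.inl u)) ∧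
    Cov X (.inr (.inl s)) ∧ (s ∉ Set.range D.P → ∃ e, Cov X (.inr (.inr e)))
  let Inf : Colour F A → Prop := fun X => (∀ t, Cov X (.inr (.inl t))) ∧
    ∃ s, s ∉ Set.range D.P → ∃ e, Cov X (.inr (.inr e))
  let Sig : Colour F A → Prop := fun X => (∀ l, Cov X (.inr (.inl (D.P l)))) ∧
    ∀ e, Cov X (.inr (.inr e))
  have hcases : ∀ X, D.Used X → Aff X ∨ Inf X ∨ Sig X := by
    rintro (⟨p, s⟩ | ⟨s, d⟩ | s | σ) ⟨hX, hX0⟩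
    · refine Or.inl ⟨s, D.φ s p, fun u hu => ?_, ?_, fun hs => ?_⟩
      · by_cases hup : u = p
        · subst hup
          by_cases hs : s ∈ Set.range D.P
          · obtain ⟨l, rfl⟩ := hs
            obtain ⟨v, hv, hvc⟩ := hAAown l u fun h => hX l (Or.inl ⟨D.φ (D.P l) u, by rw [← h]⟩)
            exact ⟨.inl v, by simpa using hv, hvc⟩
          · exact ⟨.inr (.inr ⟨s, hs⟩), by simp, rfl⟩
        · exact hbase s (D.φ s p) (.inl u) (.inl p) hu rfl (by simpa using hup) hX
      · exact hbase s (D.φ s p) (.inr s) (.inl p) rfl rfl (by simp) hX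
      · exact ⟨⟨s, hs⟩, .inl p, by simp, rfl⟩
    · refine Or.inl ⟨s, d, fun u hu => ?_, ?_, fun hs => ?_⟩
      · exact hbase s d (.inl u) (.inr s) hu rfl (by simp) hX
      · by_cases hs : s ∈ Set.range D.P
        · obtain ⟨l, rfl⟩ := hs
          obtain ⟨i, hi⟩ := hpoolpar l d hX
          obtain ⟨v, hv, hvc⟩ := hpool l i
          exact ⟨v, hv, hvc.trans hi⟩
        · obtain ⟨e, he⟩ := (hext s hs).1 d hX
          exact ⟨.inr (.inr e), by simp, (hIEext s e hs).trans he⟩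
      · obtain ⟨e, he⟩ := (hext s hs).1 d hX
        exact ⟨e, .inr (.inl s), by simp, (hIEext s e hs).trans he⟩
    · refine Or.inr (Or.inl ⟨fun t => ?_, s, fun hs => ?_⟩)
      · by_cases hts : t = s
        · subst hts
          by_cases hs : t ∈ Set.range D.P
          · obtain ⟨l, rfl⟩ := hs
            obtain ⟨i, hi⟩ := hpoolinf l
            obtain ⟨v, hv, hvc⟩ := hpool l i
            exact ⟨v, hv, hvc.trans hi⟩
          · obtain ⟨e, he⟩ := (hext t hs).2
            exact ⟨.inr (.inr e), by simp, (hIEext t e hs).trans he⟩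
        · obtain ⟨v, hv, hvc⟩ := hc₀ t s hts
          exact ⟨.inr (.inl v), by simpa using hv, congrArg inf hvc⟩
      · obtain ⟨e, he⟩ := (hext s hs).2
        exact ⟨e, .inr (.inl s), by simp, (hIEext s e hs).trans he⟩
    · have hσ : σ ≠ 0 := fun h => hX0 (by rw [h])
      refine Or.inr (Or.inr ⟨fun l => ?_, ?_⟩)
      · obtain ⟨i, hi⟩ := hpoolσ l σ hσ
        obtain ⟨v, hv, hvc⟩ := hpool l i
        exact ⟨v, hv, hvc.trans hi⟩
      -- The slope `none` is an extra vertex only when there are no layers; it then counts as `0` in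
      -- the sums, and all `some σ` are extra vertices too.
      · rintro ⟨m | m, he⟩
        · rcases hnone with h | h
          · refine ⟨.inr (.inr ⟨some σ, fun ⟨l, _⟩ => h.elim l⟩), by simp, ?_⟩
            simp [col]
          · exact absurd h he
        · by_cases hs : some (m + σ) ∈ Set.range D.P
          · obtain ⟨l, hl⟩ := hs
            refine ⟨.inr (.inl (some (m + σ))), by simp, ?_⟩
            change cIE (some (m + σ)) _ = _
            rw [← hl, hIEpool, hpoolE l _ _ _ hl rfl]
            congr 1
            rw [add_comm m, add_assoc, CharTwo.add_self_eq_zero, add_zero]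
          · refine ⟨.inr (.inr ⟨some (m + σ), hs⟩), by simpa using hσ, ?_⟩
            simp only [col, Option.getD_some]
            rw [← add_assoc, CharTwo.add_self_eq_zero, zero_add]
  have hAffInf : ∀ X Y, Aff X → Inf Y → ∃ u, Cov X u ∧ Cov Y u :=
    fun X Y ⟨s, _, _, h2, _⟩ ⟨h3, _⟩ => ⟨_, h2, h3 s⟩
  have hAffSig : ∀ X Y, Aff X → Sig Y → ∃ u, Cov X u ∧ Cov Y u := by
    rintro X Y ⟨s, d, -, h1, h2⟩ ⟨h3, h4⟩
    by_cases hs : s ∈ Set.range D.P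
    · obtain ⟨l, rfl⟩ := hs
      exact ⟨_, h1, h3 l⟩
    · obtain ⟨e, he⟩ := h2 hs
      exact ⟨_, he, h4 e⟩
  have hInfSig : ∀ X Y, Inf X → Sig Y → ∃ u, Cov X u ∧ Cov Y u := by
    rintro X Y ⟨h1, s, h2⟩ ⟨h3, h4⟩
    by_cases hs : s ∈ Set.range D.P
    · obtain ⟨l, rfl⟩ := hs
      exact ⟨_, h1 _, h3 l⟩
    · obtain ⟨e, he⟩ := h2 hs
      exact ⟨_, he, h4 e⟩
  have hsw : ∀ X Y, (∃ u, Cov X u ∧ Cov Y u) → ∃ u, Cov Y u ∧ Cov X u :=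
    fun X Y ⟨u, h, h'⟩ => ⟨u, h', h⟩
  intro X hX Y hY _
  rcases hcases X hX with h | h | h <;> rcases hcases Y hY with h' | h' | h'
  · obtain ⟨s, d, h1, h2, -⟩ := h
    obtain ⟨t, d', h3, h4, -⟩ := h'
    by_cases hst : s = t
    · subst hst
      exact ⟨_, h2, h4⟩
    · obtain ⟨p, hp, hp'⟩ := D.plane.exists_point hst d d'
      exact ⟨_, h1 p hp, h3 p hp'⟩
  · exact hAffInf X Y h h'
  · exact hAffSig X Y h h'
  · exact hsw _ _ (hAffInf Y X h' h)
  · exact ⟨_, h.1 none, h'.1 none⟩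
  · exact hInfSig X Y h h'
  · exact hsw _ _ (hAffSig Y X h' h)
  · exact hsw _ _ (hInfSig Y X h' h)
  · by_cases hs : none ∈ Set.range D.P
    · obtain ⟨l, hl⟩ := hs
      exact ⟨_, h.1 l, h'.1 l⟩
    · exact ⟨_, h.2 ⟨none, hs⟩, h'.2 ⟨none, hs⟩⟩

end LayeredPlane

/-! ### Dual hyperovals over a field of characteristic two. -/

section

variable {F : Type*} [Field F]

/-- The line with slope `s` through `p` in the affine plane over `F` is given by its intercept. -/
def intercept : Option F → F × F → F
  | some m, p => p.2 + m * p.1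
  | none, p => p.1

theorem isAffinePlane_intercept : IsAffinePlane (intercept (F := F)) where
  ext := by
    rintro (_ | s) (_ | t) ⟨x, y⟩ ⟨x', y'⟩ hst h h' <;> simp only [intercept] at h h'
    · exact absurd rfl hst
    · subst h
      rw [add_right_cancel h']
    · subst h'
      rw [add_right_cancel h]
    · have hst : s - t ≠ 0 := sub_ne_zero.2 fun h => hst (by rw [h])
      have : x = x' := mul_left_cancel₀ hst (by linear_combination h - h')
      subst this
      rw [add_right_cancel h]
  exists_point := by
    rintro (_ | s) (_ | t) hst b c
    · exact absurd rfl hst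
    · exact ⟨(b, c - t * b), rfl, by simp [intercept]⟩
    · exact ⟨(c, b - s * c), by simp [intercept], rfl⟩
    · have hst : s - t ≠ 0 := sub_ne_zero.2 fun h => hst (by rw [h])
      refine ⟨((b - c) / (s - t), b - s * ((b - c) / (s - t))), by simp [intercept], ?_⟩
      simp only [intercept]
      field_simp
      ring
  exists_slope := by
    rintro ⟨x, y⟩ ⟨x', y'⟩
    by_cases h : x = x'
    · exact ⟨none, h⟩
    · have h : x - x' ≠ 0 := sub_ne_zero.2 h
      refine ⟨some ((y' - y) / (x - x')), ?_⟩
      simp only [intercept]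
      field_simp
      ring

/-- The intercepts of the lines of a dual regular hyperoval in characteristic two. -/
def dualConic (d l : F) : Option F → F
  | some m => l * (m ^ 2 + m + d)
  | none => l

/-- The slopes of the lines through `(x, y)` are the roots of `l * m ^ 2 + (l + x) * m + (l * d +
y)`. For `x ≠ l` a root `m` has the second root `m + 1 + x / l`; for `x = l` squaring is bijective,
so there is one root, and the vertical line is the other line. -/
theorem isDualHyperoval_dualConic [CharP F 2] [Finite F] (d : F) {l : F} (hl : l ≠ 0) :
    IsDualHyperoval intercept (dualConic d l) := by
  have h2 : (2 : F) = 0 := CharTwo.two_eq_zero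
  have hsq : Function.Injective fun x : F => x ^ 2 := CharTwo.sq_injective
  rintro ⟨x, y⟩ (_ | m) h
  · have hx : x = l := h
    subst hx
    obtain ⟨m, hm⟩ := Finite.injective_iff_surjective.1 hsq ((y + x * d) / x)
    have hm : x * m ^ 2 = y + x * d := by
      rw [show m ^ 2 = (y + x * d) / x from hm]
      field_simp
    refine ⟨some m, ⟨by simp, ?_⟩, ?_⟩
    · simp only [intercept, dualConic]
      linear_combination -hm - (x * d) * h2
    · rintro (_ | t) ⟨h1, h3⟩
      · exact absurd rfl h1
      · simp only [intercept, dualConic] at h3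
        congr 1
        apply hsq
        apply mul_left_cancel₀ hl
        beta_reduce
        linear_combination -h3 - hm - (x * d) * h2
  · simp only [intercept, dualConic] at h
    by_cases hx : x = l
    · subst hx
      refine ⟨none, ⟨by simp, rfl⟩, ?_⟩
      rintro (_ | t) ⟨h1, h3⟩
      · rfl
      · simp only [intercept, dualConic] at h3
        refine absurd ?_ h1
        congr 1
        apply hsq
        apply mul_left_cancel₀ hl
        beta_reduce
        linear_combination h - h3
    · refine ⟨some (m + 1 + x / l), ⟨?_, ?_⟩, ?_⟩
      · intro h1
        rw [Option.some.injEq] at h1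
        apply hx
        have : 1 + x / l = 0 := by linear_combination h1
        field_simp at this
        linear_combination this - l * h2
      · simp only [intercept, dualConic]
        field_simp
        linear_combination l * h - (l ^ 2 * m + l ^ 2 + x * l + x * l * m) * h2
      · rintro (_ | t) ⟨h1, h3⟩
        · exact absurd h3 hx
        · simp only [intercept, dualConic] at h3
          have h1 : t - m ≠ 0 := sub_ne_zero.2 fun h => h1 (by rw [h])
          congr 1
          have : x = l * (t + m + 1) := mul_left_cancel₀ h1 (by linear_combination h3 - h)
          rw [this]
          field_simp
          linear_combination (-m - 1) * h2

theorem dualConic_injective {d : F} (hd : ∀ m : F, m ^ 2 + m + d ≠ 0) (s : Option F) :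
    Function.Injective fun l => dualConic d l s := by
  rcases s with _ | m
  · exact fun _ _ h => h
  · exact mul_left_injective₀ (hd m)

/-- `m ^ 2 + m` takes the same value at `0` and `1`, so it is not surjective on a finite field. The
resulting `d` makes dual hyperovals with different `l` disjoint. -/
theorem exists_quadratic_ne_zero [CharP F 2] [Finite F] : ∃ d : F, ∀ m : F, m ^ 2 + m + d ≠ 0 := by
  have h : ¬ Function.Surjective fun m : F => m ^ 2 + m := by
    rw [← Finite.injective_iff_surjective]
    intro h
    have h2 : (2 : F) = 0 := CharTwo.two_eq_zero
    exact zero_ne_one (h (a₁ := 0) (a₂ := 1) (by beta_reduce; linear_combination -h2))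
  simp only [Function.Surjective, not_forall, not_exists] at h
  obtain ⟨d, hd⟩ := h
  refine ⟨d, fun m hm => hd m ?_⟩
  exact CharTwo.add_eq_zero.1 hm

end

/-! ### The two bounds combined. -/

/-- The lower bound for the pseudoachromatic index that comes from a plane of even order with `N`
dual hyperovals. -/
theorem le_completeGraphPseudoachromaticIndex {q k m N K : ℕ} (hk : k ≠ 0) (hq : q = 2 ^ k)
    (hN : N < q) (hm : m + N = q ^ 2 + 2 * q + 2)
    (hK : K + 2 * q * N = q ^ 3 + 2 * q ^ 2 + 3 * q) (hK2 : 2 ≤ K) :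
    K ≤ completeGraphPseudoachromaticIndex m := by
  classical
  let F := GaloisField 2 k
  have : Fintype F := Fintype.ofFinite F
  have hF : Fintype.card F = q := by
    rw [← Nat.card_eq_fintype_card, GaloisField.card 2 k hk, hq]
  have heven : Even (Fintype.card F) := by
    rw [hF, hq]
    exact (Nat.even_pow' hk).2 even_two
  obtain ⟨d, hd⟩ := exists_quadratic_ne_zero (F := F)
  obtain ⟨l⟩ : Nonempty (Fin N ↪ {x : F // x ≠ 0}) := by
    apply Function.Embedding.nonempty_of_card_le
    rw [Fintype.card_fin, Fintype.card_subtype_compl, hF, Fintype.card_subtype_eq]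
    omega
  -- `none` is distinguished first, so that every extra vertex has a slope in `F` as soon as there
  -- is a layer.
  let P : Fin N → Option F := fun i => if i.1 = 0 then none else some (l i).1
  have hP : Function.Injective P := by
    intro i j h
    simp only [P] at h
    split_ifs at h with h1 h2 h2
    · exact Fin.ext (h1.trans h2.symm)
    · exact l.injective (Subtype.ext (by simpa using h))
  obtain ⟨D, hD⟩ := exists_layeredPlane heven intercept isAffinePlane_intercept P hP
    (fun i => dualConic d (l i)) (fun i => isDualHyperoval_dualConic d (l i).2)
    (fun s i j h => l.injective (Subtype.ext (dualConic_injective hd s h)))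
  obtain ⟨col, hsymm, hcol⟩ := D.exists_complete_colouring (by
    rcases Nat.eq_zero_or_pos N with h | h
    · subst h
      exact Or.inl inferInstance
    · exact Or.inr ⟨⟨0, h⟩, by rw [hD]; simp [P]⟩) heven
  have hused := D.card_used (by rw [Fintype.card_prod, sq])
  have hextra := D.card_extra
  rw [Fintype.card_fin, hF] at hused hextra
  have hKc : (univ.filter D.Used).card = K := by omega
  have hV : Fintype.card ((F × F) ⊕ Option F ⊕ D.Extra) = m := by
    rw [Fintype.card_sum, Fintype.card_sum, Fintype.card_prod, Fintype.card_option, hF, ← sq]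
    omega
  rw [← hKc, ← hV]
  refine card_le_completeGraphPseudoachromaticIndex col hsymm _ (by omega) ?_
  intro X hX Y hY hXY
  exact hcol X (mem_filter.1 hX).2 Y (mem_filter.1 hY).2 hXY

end

theorem theorem3 (q n m : ℕ) (a : ℤ) (hq : 4 < q) (hq2 : ∃ k : ℕ, q = 2 ^ k)
    (hn : n = q ^ 2 + q + 1)
    (ha : -1 ≤ a) (ha' : a ≤ ⌈(1 + Real.sqrt (4 * (q : ℝ) + 9)) / 2⌉ - 1)
    (hm : (m : ℤ) = (n : ℤ) + (q : ℤ) - a) :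
    (completeGraphPseudoachromaticIndex m : ℤ) = ((m : ℤ) - a) * (q : ℤ) := by
  obtain ⟨k, hk⟩ := hq2
  have hk3 : 3 ≤ k := by
    by_contra! h
    have := Nat.pow_le_pow_right (n := 2) (by norm_num) (show k ≤ 2 by omega)
    omega
  obtain ⟨j, rfl⟩ : ∃ j, k = j + 3 := ⟨k - 3, by omega⟩
  obtain ⟨t, ht, ht4⟩ : ∃ t, q = 2 * t ∧ 4 ≤ t := by
    refine ⟨2 ^ (j + 2), by rw [hk]; ring, ?_⟩
    have := Nat.pow_le_pow_right (n := 2) (by norm_num) (show 2 ≤ j + 2 by omega)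
    omega
  have ha2 : a * (a - 1) < q + 2 := by
    rcases le_or_gt a 0 with h | h
    · nlinarith
    · have h1 : (a : ℝ) < (1 + Real.sqrt (4 * (q : ℝ) + 9)) / 2 := Int.lt_ceil.1 (by omega)
      have h2 : (1 : ℝ) ≤ a := by exact_mod_cast h
      have h3 : (2 * a - 1 : ℝ) ^ 2 < 4 * (q : ℝ) + 9 := by
        rw [← Real.lt_sqrt (by linarith)]
        linarith
      have h4 : (2 * a - 1) ^ 2 < 4 * (q : ℤ) + 9 := by exact_mod_cast h3
      nlinarith
  -- This needs `q > 4`: for `q = 4` the bound on `a` would allow `a = t = 2`.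
  have hat : a < t := by
    by_contra! h
    have : (4 : ℤ) ≤ t := by exact_mod_cast ht4
    have hqt : (q : ℤ) = 2 * t := by exact_mod_cast ht
    have h1 : (t : ℤ) * 3 ≤ a * (a - 1) := mul_le_mul h (by omega) (by norm_num) (by omega)
    omega
  obtain ⟨N, hN⟩ : ∃ N : ℕ, (N : ℤ) = a + 1 := ⟨(a + 1).toNat, by omega⟩
  have hNt : N ≤ t := by omega
  have hmN : m + N = q ^ 2 + 2 * q + 2 := by
    zify
    rw [hm, hN, hn]
    push_cast
    ring
  have hqN : 2 * q * N ≤ q ^ 2 := by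
    rw [sq, mul_comm 2, mul_assoc]
    exact Nat.mul_le_mul_left q (by omega)
  obtain ⟨K, hK⟩ : ∃ K, K + 2 * q * N = q ^ 3 + 2 * q ^ 2 + 3 * q :=
    ⟨q ^ 3 + 2 * q ^ 2 + 3 * q - 2 * q * N, Nat.sub_add_cancel (by omega)⟩
  have hKa : (K : ℤ) = ((m : ℤ) - a) * q := by
    zify at hK hmN
    linear_combination hK - q * hmN - q * hN
  have hK2 : 2 ≤ K := by omega
  have hlow := le_completeGraphPseudoachromaticIndex (by omega) hk (by omega) hmN hK hK2
  have hup : completeGraphPseudoachromaticIndex m < K + 1 := by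
    have hqm : 2 * t ≤ m := by omega
    have htZ : (q : ℤ) = 2 * t := by exact_mod_cast ht
    have hmZ : (m : ℤ) = q ^ 2 + 2 * q + 1 - a := by
      rw [hm, hn]
      push_cast
      ring
    have hchoose : ∀ r : ℕ, 2 * ((r.choose 2 : ℕ) : ℤ) = r * (r - 1) := by
      intro r
      have : 2 * ((r.choose 2 : ℕ) : ℚ) = r * (r - 1) := by
        rw [Nat.cast_choose_two]
        ring
      exact_mod_cast this
    apply completeGraphPseudoachromaticIndex_lt (t := t) hqm
    · have h1 := hchoose m
      have h2 : ((m - a) * q + 1) * (q + 2) - (m : ℤ) * (m - 1) = q + 2 - a * (a - 1) := by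
        rw [hmZ]
        ring
      have h3 : 2 * (((m - a) * q + 1) * ((t : ℤ) + 1)) = ((m - a) * q + 1) * (q + 2) := by
        rw [htZ]
        ring
      zify
      rw [hKa]
      linarith
    · omega
    · have h1 := hchoose (2 * t + 1)
      have h2 : 0 ≤ (q : ℤ) * (q - 2 - 2 * a) := mul_nonneg (by omega) (by omega)
      zify [hqm]
      rw [hKa, ← htZ]
      push_cast at h1
      rw [← htZ] at h1
      linarith
  rw [← hKa]
  omega
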